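/- A graphic 2-XOR-CNF $\varphi$ over Boolean variables $x_1,\dots,x_n$ is a sequence of pairwise distinct clauses $C_1,\dots,C_m$, each of the form $x=y$ (that is, $x+y=0$ over $\mathrm{GF}(2)$) or $x\neq y$ (that is, $x+y=1$) with two distinct variables $x,y$. The signature produced by an assignment $a$ of the variables is the bit string $\sigma(a)=(C_1(a),\dots,C_m(a))\in\{0,1\}^m$, where $C_j(a)=1$ if $a$ satisfies $C_j$ and $C_j(a)=0$ otherwise; a signature is maximal if it is maximal among all signatures of $\varphi$ for the bitwise order. An edge-bicolored multigraph here has a finite vertex set and edges $e_1,\dots,e_m$, each colored red or blue and joining two distinct vertices, such that no two edges of the same color have the same end points. The multigraph $G(\varphi)$ has the variables of $\varphi$ as vertices, and its edge $e_j$ joins the two variables of $C_j$; it is blue if $C_j$ is $x\neq y$ and red if $C_j$ is $x=y$. A subgraph is given by its edge set $H$, its vertices being the end points of the edges in $H$. It is red-blue bipartite if its vertex set has a partition into two (possibly empty) parts $X,Y$ such that the edges of $H$ with one end point in $X$ and the other in $Y$ are exactly the blue edges of $H$. It is maximal if it is inclusion-maximal, as an edge set, among the red-blue bipartite subgraphs.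 Theorem. (1) There is an algorithm that, given a graphic 2-XOR-CNF $\varphi$, lists the maximal signatures of $\varphi$ without repetition, with polynomial delay and in polynomial space, if and only if there is an algorithm that, given a multigraph $G(\varphi)$ of a graphic 2-XOR-CNF, lists its maximal red-blue bipartite subgraphs without repetition, with polynomial delay and in polynomial space. (Polynomial delay: the time before the first output, between two consecutive outputs, and from the last output to the end is bounded by a polynomial in the length of the input. Polynomial space: the memory in use, with solutions not being kept after their output, is bounded by a polynomial in the length of the input.) (2) The map $\varphi\mapsto G(\varphi)$ is a bijection from the graphic 2-XOR-CNFs to the edge-bicolored multigraphs as above (with vertices identified with the variables). For every graphic 2-XOR-CNF $\varphi$ and every $\sigma\in\{0,1\}^m$, $\sigma$ is a maximal signature of $\varphi$ if and only if the subgraph $\{e_j : \sigma_j=1\}$ of $G(\varphi)$ is a maximal red-blue bipartite subgraph, and $\sigma\mapsto\{e_j:\sigma_j=1\}$ is a bijection from the maximal signatures of $\varphi$ to the maximal red-blue bipartite subgraphs of $G(\varphi)$. -/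

import Mathlib

/-! ### Enumeration algorithms -/

/-- An enumeration problem. Each instance `i` has a finite description `encodeInst i`, a type
`Sol i` of candidate solutions, an encoding of these, and the set `solutions i` to be listed. -/
structure EnumProblem where
  Instance : Type
  InSym : Type
  encodeInst : Instance → List InSym
  encodeInst_injective : Function.Injective encodeInst
  Sol : Instance → Type
  OutSym : Type
  encodeSol : (i : Instance) → Sol i → List OutSym
  encodeSol_injective : ∀ i, Function.Injective (encodeSol i)
  solutions : (i : Instance) → Set (Sol i)

/-- An enumeration machine: a finite multi-stack Turing machine, in which some labels are output
labels. Whenever the control of the machine is at an output label, the current content of the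
output stack `k₁` (top first) is output; the machine then goes on. -/
structure EnumMachine (InSym OutSym : Type) where
  tm : Turing.FinTM2
  finite_alphabets : ∀ k, Finite (tm.Γ k)
  inputAlphabet : tm.Γ tm.k₀ ≃ InSym
  outputAlphabet : tm.Γ tm.k₁ ≃ OutSym
  outputLabels : Set tm.Λ

namespace EnumMachine

variable {InSym OutSym : Type} (M : EnumMachine InSym OutSym)

/-- The configuration after `t` steps on input `w`; it is `none` once the machine has halted and
no step can be made any more. -/
def run (w : List InSym) (t : ℕ) : Option M.tm.Cfg :=
  (fun c => c.bind M.tm.step)^[t]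
    (some (Turing.initList M.tm (w.map M.inputAlphabet.symm)))

/-- On input `w`, the word `out` is output at time `t`. -/
def OutputsAt (w : List InSym) (t : ℕ) (out : List OutSym) : Prop :=
  ∃ c : M.tm.Cfg, M.run w t = some c ∧ (∃ l ∈ M.outputLabels, c.l = some l) ∧
    (c.stk M.tm.k₁).map M.outputAlphabet = out

/-- On input `w`, the machine outputs exactly the words in `S`, each exactly once. -/
def Enumerates (w : List InSym) (S : Set (List OutSym)) : Prop :=
  (∀ out, (∃ t, M.OutputsAt w t out) ↔ out ∈ S) ∧
    ∀ s t out, M.OutputsAt w s out → M.OutputsAt w t out → s = t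

/-- On input `w`, from the start and from any later moment at which the machine still runs, at
most `d` steps pass until the next output or the end of the computation. In particular this bounds
the time before the first output, between two consecutive outputs, and after the last one. -/
def DelayAtMost (w : List InSym) (d : ℕ) : Prop :=
  ∀ t, M.run w t ≠ none →
    ∃ s, t < s ∧ s ≤ t + d ∧ (M.run w s = none ∨ ∃ out, M.OutputsAt w s out)

/-- On input `w`, the stacks never hold more than `b` symbols in total. -/
def SpaceAtMost (w : List InSym) (b : ℕ) : Prop :=
  ∀ t c, M.run w t = some c → ∑ k ∈ M.tm.kFin.elems, (c.stk k).length ≤ b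

end EnumMachine

/-- There is an algorithm with polynomial delay and polynomial space (both in the length of the
description of the instance) that lists the solutions of every instance without repetition. -/
def EnumProblem.PolyDelayPolySpace (P : EnumProblem) : Prop :=
  ∃ (M : EnumMachine P.InSym P.OutSym) (d b : Polynomial ℕ), ∀ i : P.Instance,
    M.Enumerates (P.encodeInst i) (P.encodeSol i '' P.solutions i) ∧
    M.DelayAtMost (P.encodeInst i) (d.eval (P.encodeInst i).length) ∧
    M.SpaceAtMost (P.encodeInst i) (b.eval (P.encodeInst i).length)

/-! ### XOR formulas and signatures -/

/-- The XOR-clause `∑ x ∈ vars, x = rhs` over the two-element field, in the variables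
`x₀, …, x_{n-1}`. -/
@[ext] structure XORClause (n : ℕ) where
  vars : Finset (Fin n)
  rhs : ZMod 2

/-- A graphic 2-XOR-CNF: pairwise distinct clauses `C_0, …, C_{m-1}`, each of the form `x + y = 0`
(that is, `x = y`) or `x + y = 1` (that is, `x ≠ y`) with two distinct variables `x`, `y`. -/
structure GraphicXORCNF where
  n : ℕ
  m : ℕ
  clause : Fin m → XORClause n
  two_vars : ∀ j, (clause j).vars.card = 2
  distinct : Function.Injective clause

namespace GraphicXORCNF

variable (φ : GraphicXORCNF)

/-- The signature produced by the assignment `a`. -/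
def signature (a : Fin φ.n → ZMod 2) : Fin φ.m → Bool :=
  fun j => decide (∑ x ∈ (φ.clause j).vars, a x = (φ.clause j).rhs)

def IsSignature (σ : Fin φ.m → Bool) : Prop :=
  ∃ a, φ.signature a = σ

/-- Maximality is with respect to the bitwise order. -/
def IsMaximalSignature (σ : Fin φ.m → Bool) : Prop :=
  Maximal φ.IsSignature σ

end GraphicXORCNF

/-! ### Edge-bicolored multigraphs -/

inductive EdgeColor
  | red
  | blue
  deriving DecidableEq

@[ext] structure BicoloredEdge (n : ℕ) where
  ends : Finset (Fin n)
  color : EdgeColor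

/-- An edge-bicolored multigraph with vertices `0, …, n-1` and edges `e_0, …, e_{m-1}`, each with
two distinct end points, in which no two edges of the same color have the same end points. -/
structure BicoloredMultigraph where
  n : ℕ
  m : ℕ
  edge : Fin m → BicoloredEdge n
  two_ends : ∀ j, (edge j).ends.card = 2
  distinct : Function.Injective edge

namespace BicoloredMultigraph

variable (G : BicoloredMultigraph)

/-- The vertex set of the subgraph with edge set `H`: the end points of its edges. -/
def verts (H : Finset (Fin G.m)) : Finset (Fin G.n) :=
  H.biUnion fun j => (G.edge j).ends

/-- `B(H)`, the set of blue edges of `H`. -/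
def blueEdges (H : Finset (Fin G.m)) : Finset (Fin G.m) :=
  H.filter fun j => (G.edge j).color = EdgeColor.blue

/-- `δ_H(X, Y)`, the edges of `H` with one end point in `X` and the other in `Y`. -/
def crossingEdges (H : Finset (Fin G.m)) (X Y : Finset (Fin G.n)) : Finset (Fin G.m) :=
  H.filter fun j => ∃ x ∈ X, ∃ y ∈ Y, (G.edge j).ends = {x, y}

/-- The vertex set of the subgraph with edge set `H` has a bipartition `(X, Y)` (a part may be
empty) such that the edges of `H` between `X` and `Y` are exactly the blue edges of `H`. -/
def IsRedBlueBipartite (H : Finset (Fin G.m)) : Prop :=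
  ∃ X Y : Finset (Fin G.n), X ∪ Y = G.verts H ∧ Disjoint X Y ∧
    G.crossingEdges H X Y = G.blueEdges H

/-- Maximality is with respect to inclusion of edge sets. -/
def IsMaximalRedBlueBipartite (H : Finset (Fin G.m)) : Prop :=
  Maximal G.IsRedBlueBipartite H

end BicoloredMultigraph

/-! ### The multigraph of a formula -/

/-- A clause `x ≠ y` gives a blue edge `xy`, a clause `x = y` a red edge `xy`. -/
def XORClause.toEdge {n : ℕ} (C : XORClause n) : BicoloredEdge n where
  ends := C.vars
  color := if C.rhs = 1 then EdgeColor.blue else EdgeColor.red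

theorem XORClause.toEdge_injective {n : ℕ} :
    Function.Injective (XORClause.toEdge (n := n)) := by
  rintro ⟨v, r⟩ ⟨w, s⟩ h
  simp only [XORClause.toEdge, BicoloredEdge.mk.injEq] at h
  obtain ⟨rfl, h⟩ := h
  have key : ∀ r s : ZMod 2, (if r = 1 then EdgeColor.blue else EdgeColor.red) =
      (if s = 1 then EdgeColor.blue else EdgeColor.red) → r = s := by decide
  rw [key r s h]

/-- The multigraph `G(φ)`: its vertices are the variables of `φ`, and its edge `e_j` comes from the
clause `C_j`. -/
abbrev GraphicXORCNF.toGraph (φ : GraphicXORCNF) : BicoloredMultigraph where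
  n := φ.n
  m := φ.m
  edge j := (φ.clause j).toEdge
  two_ends := φ.two_vars
  distinct := XORClause.toEdge_injective.comp φ.distinct

/-- The subgraph `{e_j : σ[j] = 1}` of `G(φ)`. -/
def GraphicXORCNF.subgraphOf (φ : GraphicXORCNF) (σ : Fin φ.m → Bool) :
    Finset (Fin φ.toGraph.m) :=
  (Finset.univ.filter fun j : Fin φ.m => σ j = true : Finset (Fin φ.m))

/-! ### Encodings -/

/-- A number in binary, least significant bit first, followed by the separator `sep`. -/
def encodeNatSep {A : Type} (bit : Bool → A) (sep : A) (x : ℕ) : List A :=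
  (Computability.encodeNat x).map bit ++ [sep]

/-- The symbols in which formulas are written. -/
inductive FormulaSym
  | tick
  | bit (b : Bool)
  | plus
  | rhs (ε : ZMod 2)
  deriving DecidableEq

/-- A clause is written as its variables in increasing order, each in binary and followed by a
`plus`, and then the right-hand side. -/
def XORClause.encode {n : ℕ} (C : XORClause n) : List FormulaSym :=
  (C.vars.sort (· ≤ ·)).flatMap (fun x : Fin n => encodeNatSep FormulaSym.bit FormulaSym.plus x) ++
    [FormulaSym.rhs C.rhs]

/-- A formula is written as the number of variables in unary, followed by the list of its
clauses. -/
def GraphicXORCNF.encode (φ : GraphicXORCNF) : List FormulaSym :=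
  List.replicate φ.n FormulaSym.tick ++ (List.ofFn φ.clause).flatMap XORClause.encode

/-- The symbols in which multigraphs are written. -/
inductive GraphSym
  | tick
  | bit (b : Bool)
  | sep
  | color (c : EdgeColor)
  deriving DecidableEq

/-- An edge is written as its color, followed by its end points in increasing order, each in binary
and followed by a separator. -/
def BicoloredEdge.encode {n : ℕ} (e : BicoloredEdge n) : List GraphSym :=
  GraphSym.color e.color ::
    (e.ends.sort (· ≤ ·)).flatMap (fun x : Fin n => encodeNatSep GraphSym.bit GraphSym.sep x)

/-- A multigraph is written as the number of vertices in unary, followed by the list of its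
edges. -/
def BicoloredMultigraph.encode (G : BicoloredMultigraph) : List GraphSym :=
  List.replicate G.n GraphSym.tick ++ (List.ofFn G.edge).flatMap BicoloredEdge.encode

/-- A set of edges is written as its characteristic vector, with one bit for each of the edges
`e_0, …, e_{m-1}`. -/
def BicoloredMultigraph.encodeSubgraph (G : BicoloredMultigraph) (H : Finset (Fin G.m)) :
    List Bool :=
  List.ofFn fun j => decide (j ∈ H)

/-! The encodings are injective. -/

theorem encodeNatSep_append {A : Type} {bit : Bool → A} {sep : A}
    (hbit : Function.Injective bit) (hsep : ∀ b, bit b ≠ sep) {x y : ℕ} {s t : List A}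
    (h : encodeNatSep bit sep x ++ s = encodeNatSep bit sep y ++ t) : x = y ∧ s = t := by
  have key : ∀ u v : List Bool, u.map bit ++ [sep] ++ s = v.map bit ++ [sep] ++ t →
      u = v ∧ s = t := by
    intro u
    induction u with
    | nil =>
      intro v hv
      cases v with
      | nil => simpa using hv
      | cons b v => exact absurd (List.cons.inj hv).1.symm (hsep b)
    | cons a u ih =>
      intro v hv
      cases v with
      | nil => exact absurd (List.cons.inj hv).1 (hsep a)
      | cons b v =>
        obtain ⟨h1, h2⟩ := List.cons.inj hv
        obtain ⟨h3, h4⟩ := ih v h2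
        exact ⟨by rw [hbit h1, h3], h4⟩
  obtain ⟨h1, h2⟩ := key _ _ h
  refine ⟨?_, h2⟩
  rw [← Computability.decode_encodeNat x, h1, Computability.decode_encodeNat]

theorem encodePair_append {A : Type} {bit : Bool → A} {sep : A}
    (hbit : Function.Injective bit) (hsep : ∀ b, bit b ≠ sep) {n : ℕ} {V W : Finset (Fin n)}
    (hV : V.card = 2) (hW : W.card = 2) {s t : List A}
    (h : (V.sort (· ≤ ·)).flatMap (fun x : Fin n => encodeNatSep bit sep x) ++ s =
      (W.sort (· ≤ ·)).flatMap (fun x : Fin n => encodeNatSep bit sep x) ++ t) : V = W ∧ s = t := by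
  have hV' : (V.sort (· ≤ ·)).length = 2 := by rw [Finset.length_sort, hV]
  have hW' : (W.sort (· ≤ ·)).length = 2 := by rw [Finset.length_sort, hW]
  obtain ⟨a, b, hab⟩ := List.length_eq_two.1 hV'
  obtain ⟨c, d, hcd⟩ := List.length_eq_two.1 hW'
  rw [hab, hcd] at h
  simp only [List.flatMap_cons, List.flatMap_nil, List.append_nil, List.append_assoc] at h
  obtain ⟨h1, h2⟩ := encodeNatSep_append hbit hsep h
  obtain ⟨h3, h4⟩ := encodeNatSep_append hbit hsep h2
  refine ⟨?_, h4⟩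
  rw [← Finset.sort_toFinset V (· ≤ ·), ← Finset.sort_toFinset W (· ≤ ·), hab, hcd,
    Fin.ext h1, Fin.ext h3]

theorem flatMap_inj_of_prefix {A B : Type} {P : B → Prop} {f : B → List A}
    (hne : ∀ x, f x ≠ [])
    (hf : ∀ x y s t, P x → P y → f x ++ s = f y ++ t → x = y ∧ s = t) :
    ∀ u v : List B, (∀ x ∈ u, P x) → (∀ x ∈ v, P x) → u.flatMap f = v.flatMap f → u = v := by
  intro u
  induction u with
  | nil =>
    intro v _ _ h
    cases v with
    | nil => rfl
    | cons b v => simp [hne] at h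
  | cons a u ih =>
    intro v hu hv h
    cases v with
    | nil => simp [hne] at h
    | cons b v =>
      simp only [List.flatMap_cons] at h
      obtain ⟨h1, h2⟩ := hf _ _ _ _ (hu a (by simp)) (hv b (by simp)) h
      rw [h1, ih v (fun x hx => hu x (by simp [hx])) (fun x hx => hv x (by simp [hx])) h2]

theorem replicate_append_inj {A : Type} {c : A} :
    ∀ (n k : ℕ) (s t : List A), c ∉ s → c ∉ t →
      List.replicate n c ++ s = List.replicate k c ++ t → n = k ∧ s = t := by
  intro n
  induction n with
  | zero =>
    intro k s t hs _ h
    cases k with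
    | zero => simpa using h
    | succ k => exact absurd (by simp [show s = _ from h, List.replicate_succ]) hs
  | succ n ih =>
    intro k s t hs ht h
    cases k with
    | zero => exact absurd (by simp [← show _ = t from h, List.replicate_succ]) ht
    | succ k =>
      simp only [List.replicate_succ, List.cons_append, List.cons.injEq, true_and] at h
      obtain ⟨h1, h2⟩ := ih k s t hs ht h
      exact ⟨by rw [h1], h2⟩

theorem GraphicXORCNF.encode_injective : Function.Injective GraphicXORCNF.encode := by
  rintro ⟨n, m, C, hC, dC⟩ ⟨n', m', D, hD, dD⟩ h
  have tick_not_mem : ∀ {n : ℕ} (l : List (XORClause n)),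
      FormulaSym.tick ∉ l.flatMap XORClause.encode := by
    intro n l
    simp [XORClause.encode, encodeNatSep]
  obtain ⟨rfl, h2⟩ := replicate_append_inj _ _ _ _ (tick_not_mem _) (tick_not_mem _) h
  have h3 := flatMap_inj_of_prefix (P := fun K : XORClause n => K.vars.card = 2)
    (by simp [XORClause.encode])
    (by
      intro K L s t hK hL hKL
      simp only [XORClause.encode, List.append_assoc] at hKL
      obtain ⟨h4, h5⟩ := encodePair_append (fun _ _ hb => FormulaSym.bit.inj hb)
        (by simp) hK hL hKL
      simp only [List.singleton_append, List.cons.injEq, FormulaSym.rhs.injEq] at h5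
      exact ⟨XORClause.ext h4 h5.1, h5.2⟩)
    _ _ (by simpa using hC) (by simpa using hD) h2
  obtain rfl : m = m' := by simpa using congrArg List.length h3
  obtain rfl : C = D := List.ofFn_injective h3
  rfl

theorem BicoloredMultigraph.encode_injective :
    Function.Injective BicoloredMultigraph.encode := by
  rintro ⟨n, m, C, hC, dC⟩ ⟨n', m', D, hD, dD⟩ h
  have tick_not_mem : ∀ {n : ℕ} (l : List (BicoloredEdge n)),
      GraphSym.tick ∉ l.flatMap BicoloredEdge.encode := by
    intro n l
    simp [BicoloredEdge.encode, encodeNatSep]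
  obtain ⟨rfl, h2⟩ := replicate_append_inj _ _ _ _ (tick_not_mem _) (tick_not_mem _) h
  have h3 := flatMap_inj_of_prefix (P := fun K : BicoloredEdge n => K.ends.card = 2)
    (by simp [BicoloredEdge.encode])
    (by
      intro K L s t hK hL hKL
      simp only [BicoloredEdge.encode, List.cons_append, List.cons.injEq,
        GraphSym.color.injEq] at hKL
      obtain ⟨h4, h5⟩ := encodePair_append (fun _ _ hb => GraphSym.bit.inj hb)
        (by simp) hK hL hKL.2
      exact ⟨BicoloredEdge.ext h4 hKL.1, h5⟩)
    _ _ (by simpa using hC) (by simpa using hD) h2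
  obtain rfl : m = m' := by simpa using congrArg List.length h3
  obtain rfl : C = D := List.ofFn_injective h3
  rfl

theorem BicoloredMultigraph.encodeSubgraph_injective (G : BicoloredMultigraph) :
    Function.Injective G.encodeSubgraph := by
  intro H K h
  ext j
  simpa using congrFun (List.ofFn_injective h) j

/-! ### The two enumeration problems -/

/-- Given a graphic 2-XOR-CNF, list its maximal signatures, written as bit strings. -/
abbrev maximalSignatures : EnumProblem where
  Instance := GraphicXORCNF
  InSym := FormulaSym
  encodeInst := GraphicXORCNF.encode
  encodeInst_injective := GraphicXORCNF.encode_injective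
  Sol φ := Fin φ.m → Bool
  OutSym := Bool
  encodeSol _ σ := List.ofFn σ
  encodeSol_injective _ := List.ofFn_injective
  solutions φ := {σ | φ.IsMaximalSignature σ}

/-- Given an edge-bicolored multigraph, list its maximal red-blue bipartite subgraphs. -/
abbrev maximalRedBlueBipartiteSubgraphs : EnumProblem where
  Instance := BicoloredMultigraph
  InSym := GraphSym
  encodeInst := BicoloredMultigraph.encode
  encodeInst_injective := BicoloredMultigraph.encode_injective
  Sol G := Finset (Fin G.m)
  OutSym := Bool
  encodeSol G H := G.encodeSubgraph H
  encodeSol_injective G := G.encodeSubgraph_injective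
  solutions G := {H | G.IsMaximalRedBlueBipartite H}

/-!
Fix a vertex bipartition `(X, Y)` and the assignment that is `1` exactly on `X`. An edge crosses
from `X` to `Y` if and only if the two variables of its clause differ, so the crossing edges of `H`
are its blue edges if and only if the assignment satisfies every clause in `H`. Hence the red-blue
bipartite subgraphs are the down-closure of the signatures, and a set and its down-closure have the
same maximal elements.

For the algorithms, the two descriptions of an instance differ, up to renaming letters, only in
that the color of an edge precedes its end points while the right-hand side of a clause follows its
variables. A transducer that holds back one letter converts either into the other, reading formulas
from their end. An enumeration machine can be made to run a transducer on its input first, at linear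
cost in time and space; since the translated word is pushed on a stack, it comes out reversed, and a
second pass restores its order.
-/

/-! ### Signatures and red-blue bipartite subgraphs -/

/-- The correspondence between the right-hand sides of clauses and the colors of edges. -/
def rhsEquivColor : ZMod 2 ≃ EdgeColor where
  toFun r := if r = 1 then .blue else .red
  invFun
    | .red => 0
    | .blue => 1
  left_inv := by decide
  right_inv := by rintro (_ | _) <;> decide

/-- The correspondence between clauses and bicolored edges. -/
def clauseEquivEdge (n : ℕ) : XORClause n ≃ BicoloredEdge n where
  toFun := XORClause.toEdge
  invFun e := ⟨e.ends, rhsEquivColor.symm e.color⟩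
  left_inv C := XORClause.ext rfl (rhsEquivColor.symm_apply_apply C.rhs)
  right_inv e := BicoloredEdge.ext rfl (rhsEquivColor.apply_symm_apply e.color)

/-- The formula of which a given multigraph is the multigraph. -/
def BicoloredMultigraph.toFormula (G : BicoloredMultigraph) : GraphicXORCNF where
  n := G.n
  m := G.m
  clause j := (clauseEquivEdge G.n).symm (G.edge j)
  two_vars := G.two_ends
  distinct := (clauseEquivEdge G.n).symm.injective.comp G.distinct

theorem BicoloredMultigraph.toGraph_toFormula (G : BicoloredMultigraph) :
    G.toFormula.toGraph = G := by
  have edge_eq (j) : ((clauseEquivEdge G.n).symm (G.edge j)).toEdge = G.edge j :=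
    (clauseEquivEdge G.n).apply_symm_apply (G.edge j)
  simp only [toFormula, GraphicXORCNF.toGraph, edge_eq]

theorem GraphicXORCNF.toFormula_toGraph (φ : GraphicXORCNF) : φ.toGraph.toFormula = φ := by
  have clause_eq (j) : (clauseEquivEdge φ.n).symm (φ.clause j).toEdge = φ.clause j :=
    (clauseEquivEdge φ.n).symm_apply_apply (φ.clause j)
  simp only [BicoloredMultigraph.toFormula, clause_eq]

theorem GraphicXORCNF.toGraph_bijective : Function.Bijective GraphicXORCNF.toGraph :=
  Function.bijective_iff_has_inverse.2
    ⟨BicoloredMultigraph.toFormula, toFormula_toGraph, BicoloredMultigraph.toGraph_toFormula⟩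

theorem zmod_two_eq_iff : ∀ r s : ZMod 2, r = s ↔ (r = 1 ↔ s = 1) := by
  decide

theorem exists_eq_pair_iff_sum_eq_one {α : Type*} [DecidableEq α] {e X Y : Finset α}
    {a : α → ZMod 2} (he : e.card = 2) (hcover : e ⊆ X ∪ Y) (hXY : Disjoint X Y)
    (ha : ∀ z ∈ e, a z = 1 ↔ z ∈ X) :
    (∃ x ∈ X, ∃ y ∈ Y, e = {x, y}) ↔ ∑ z ∈ e, a z = 1 := by
  constructor
  · rintro ⟨x, hx, y, hy, rfl⟩
    have hyX : y ∉ X := Finset.disjoint_right.1 hXY hy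
    have hax : a x = 1 := (ha x (by simp)).2 hx
    have hay : a y ≠ 1 := fun h => hyX ((ha y (by simp)).1 h)
    rw [Finset.sum_pair (ne_of_mem_of_not_mem hx hyX), hax]
    revert hay
    generalize a y = r
    revert r
    decide
  · obtain ⟨x, y, hxy, rfl⟩ := Finset.card_eq_two.1 he
    have one_of_add : ∀ r s : ZMod 2, r + s = 1 → r = 1 ∧ s ≠ 1 ∨ s = 1 ∧ r ≠ 1 := by decide
    have mem_right (z) (hz : z ∈ ({x, y} : Finset α)) (h : a z ≠ 1) : z ∈ Y :=
      (Finset.mem_union.1 (hcover hz)).resolve_left fun hX => h ((ha z hz).2 hX)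
    intro h
    rw [Finset.sum_pair hxy] at h
    rcases one_of_add _ _ h with ⟨hx, hy⟩ | ⟨hy, hx⟩
    · exact ⟨x, (ha x (by simp)).1 hx, y, mem_right y (by simp) hy, rfl⟩
    · exact ⟨y, (ha y (by simp)).1 hy, x, mem_right x (by simp) hx, Finset.pair_comm x y⟩

theorem XORClause.toEdge_color_eq_blue_iff {n : ℕ} (C : XORClause n) :
    C.toEdge.color = .blue ↔ C.rhs = 1 := by
  simp [toEdge]

theorem maximal_mem_lowerClosure_iff {α : Type*} [PartialOrder α] {s : Set α} {x : α} :
    Maximal (· ∈ lowerClosure s) x ↔ Maximal (· ∈ s) x := by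
  constructor
  · intro h
    obtain ⟨y, hy, hxy⟩ := mem_lowerClosure.1 h.prop
    obtain rfl : x = y := h.eq_of_le (subset_lowerClosure hy) hxy
    exact h.mono (fun _ hz => subset_lowerClosure hz) hy
  · intro h
    refine ⟨subset_lowerClosure h.prop, fun y hy hxy => ?_⟩
    obtain ⟨z, hz, hyz⟩ := mem_lowerClosure.1 hy
    exact hyz.trans (h.le_of_ge hz (hxy.trans hyz))

namespace GraphicXORCNF

variable (φ : GraphicXORCNF)

theorem mem_subgraphOf {σ : Fin φ.m → Bool} {j : Fin φ.m} :
    j ∈ φ.subgraphOf σ ↔ σ j = true := by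
  simp [subgraphOf]

/-- `subgraphOf` as an isomorphism from the bitwise order on bit strings to the inclusion order on
edge sets. -/
def subgraphIso : (Fin φ.m → Bool) ≃o Finset (Fin φ.m) where
  toFun := φ.subgraphOf
  invFun H j := decide (j ∈ H)
  left_inv _ := funext fun _ => Bool.eq_iff_iff.2 (decide_eq_true_iff.trans φ.mem_subgraphOf)
  right_inv _ := Finset.ext fun _ => φ.mem_subgraphOf.trans decide_eq_true_iff
  map_rel_iff' := by
    simp only [Pi.le_def, Bool.le_iff_imp, ← mem_subgraphOf]
    exact Iff.rfl

theorem crossingEdges_eq_blueEdges_iff {H : Finset (Fin φ.m)} {X Y : Finset (Fin φ.n)}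
    {a : Fin φ.n → ZMod 2} (hcover : X ∪ Y = φ.toGraph.verts H) (hXY : Disjoint X Y)
    (ha : ∀ z ∈ φ.toGraph.verts H, a z = 1 ↔ z ∈ X) :
    φ.toGraph.crossingEdges H X Y = φ.toGraph.blueEdges H ↔
      H ⊆ φ.subgraphOf (φ.signature a) := by
  refine Finset.filter_inj'.trans (forall₂_congr fun j hj => ?_)
  have ends_subset : (φ.clause j).vars ⊆ φ.toGraph.verts H :=
    Finset.subset_biUnion_of_mem (fun j => (φ.toGraph.edge j).ends) hj
  calc
    _ ↔ (∑ z ∈ (φ.clause j).vars, a z = 1 ↔ (φ.clause j).rhs = 1) :=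
      iff_congr
        (exists_eq_pair_iff_sum_eq_one (φ.two_vars j) (hcover ▸ ends_subset) hXY
          fun z hz => ha z (ends_subset hz))
        (φ.clause j).toEdge_color_eq_blue_iff
    _ ↔ ∑ z ∈ (φ.clause j).vars, a z = (φ.clause j).rhs := (zmod_two_eq_iff _ _).symm
    _ ↔ j ∈ φ.subgraphOf (φ.signature a) := by rw [mem_subgraphOf, signature, decide_eq_true_iff]

theorem isRedBlueBipartite_subgraphOf_iff (σ : Fin φ.m → Bool) :
    φ.toGraph.IsRedBlueBipartite (φ.subgraphOf σ) ↔ σ ∈ lowerClosure {τ | φ.IsSignature τ} := by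
  rw [mem_lowerClosure]
  constructor
  · rintro ⟨X, Y, hcover, hXY, heq⟩
    exact ⟨_, ⟨fun z => if z ∈ X then 1 else 0, rfl⟩, φ.subgraphIso.le_iff_le.1
      ((φ.crossingEdges_eq_blueEdges_iff hcover hXY fun z _ => by simp).1 heq)⟩
  · rintro ⟨_, ⟨a, rfl⟩, hle⟩
    have hcover := Finset.filter_union_filter_not_eq (a · = 1) (φ.toGraph.verts (φ.subgraphOf σ))
    have hXY := Finset.disjoint_filter_filter_not (φ.toGraph.verts (φ.subgraphOf σ))
      (φ.toGraph.verts (φ.subgraphOf σ)) (a · = 1)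
    exact ⟨_, _, hcover, hXY, (φ.crossingEdges_eq_blueEdges_iff hcover hXY
      fun z hz => by simp [hz]).2 (φ.subgraphIso.le_iff_le.2 hle)⟩

theorem isMaximalSignature_iff (σ : Fin φ.m → Bool) : φ.IsMaximalSignature σ ↔
    φ.toGraph.IsMaximalRedBlueBipartite (φ.subgraphOf σ) :=
  calc
    φ.IsMaximalSignature σ ↔ Maximal (· ∈ lowerClosure {τ | φ.IsSignature τ}) σ :=
      maximal_mem_lowerClosure_iff.symm
    _ ↔ Maximal (fun τ => φ.toGraph.IsRedBlueBipartite (φ.subgraphOf τ)) σ := by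
      simp only [isRedBlueBipartite_subgraphOf_iff]
    _ ↔ φ.toGraph.IsMaximalRedBlueBipartite (φ.subgraphOf σ) :=
      (φ.subgraphIso.toOrderEmbedding.maximal_apply_mem_iff
        (t := {H | φ.toGraph.IsRedBlueBipartite H})
        fun H _ => φ.subgraphIso.surjective H).symm

theorem bijOn_subgraphOf : Set.BijOn φ.subgraphOf {σ | φ.IsMaximalSignature σ}
    {H | φ.toGraph.IsMaximalRedBlueBipartite H} :=
  φ.subgraphIso.toEquiv.bijOn fun σ => (φ.isMaximalSignature_iff σ).symm

theorem encodeSubgraph_subgraphOf (σ : Fin φ.m → Bool) :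
    φ.toGraph.encodeSubgraph (φ.subgraphOf σ) = List.ofFn σ :=
  congrArg List.ofFn (φ.subgraphIso.symm_apply_apply σ)

theorem image_encodeSubgraph :
    φ.toGraph.encodeSubgraph '' {H | φ.toGraph.IsMaximalRedBlueBipartite H} =
      List.ofFn '' {σ | φ.IsMaximalSignature σ} := by
  rw [← φ.bijOn_subgraphOf.image_eq, Set.image_image]
  exact Set.image_congr fun σ _ => φ.encodeSubgraph_subgraphOf σ

end GraphicXORCNF

/-! ### Transducers -/

/-- A sequential transducer with states `Q`. On each letter it changes its state and writes at most
one letter; at the end of the word, in state `q`, it writes `final q`, if anything. -/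
structure Transducer (A Q B : Type) where
  start : Q
  next : Q → A → Q × Option B
  final : Q → Option B

namespace Transducer

variable {A Q B : Type} (T : Transducer A Q B)

/-- The word written on reading a word from a given state on. -/
def eval : Q → List A → List B
  | q, [] => (T.final q).toList
  | q, a :: w => (T.next q a).2.toList ++ eval (T.next q a).1 w

/-- The function on words computed by a transducer. -/
def output (w : List A) : List B :=
  T.eval T.start w

theorem length_eval_le (q : Q) (w : List A) : (T.eval q w).length ≤ w.length + 1 := by
  induction w generalizing q with
  | nil => exact Option.length_toList_le
  | cons a w ih =>
    rw [eval, List.length_append, List.length_cons, Nat.add_comm]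
    exact Nat.add_le_add (ih _) Option.length_toList_le

/-- One reading step, in a form a machine can carry out: the end of the word is a letter `none`,
and the state is `none` from then on. -/
def read : Option Q → Option A → Option Q × Option B
  | some q, some a => (some (T.next q a).1, (T.next q a).2)
  | some q, none => (none, T.final q)
  | none, _ => (none, none)

end Transducer

/-! ### Machines with one more stack -/

namespace EnumMachine

open Turing Turing.TM2

section AddStack

variable {K : Type} (A : Type) (Γ : K → Type)

/-- The stack alphabets after the addition of a stack with alphabet `A`. -/
abbrev AddStack : Option K → Type
  | none => A
  | some k => Γ k

variable {A Γ}

/-- The stack contents after the addition of a stack with content `w`. -/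
def addStack (w : List A) (S : ∀ k, List (Γ k)) : ∀ k, List (AddStack A Γ k)
  | none => w
  | some k => S k

theorem update_addStack_none [DecidableEq K] (w w' : List A) (S : ∀ k, List (Γ k)) :
    Function.update (addStack w S) none w' = addStack w' S := by
  funext k
  cases k <;> simp [addStack]

theorem update_addStack_some [DecidableEq K] (w : List A) (S : ∀ k, List (Γ k)) (k : K)
    (x : List (Γ k)) :
    Function.update (addStack w S) (some k) x = addStack w (Function.update S k x) := by
  funext k'
  obtain _ | k' := k'
  · simp [addStack]
  · obtain rfl | h := eq_or_ne k' k <;> simp [addStack, *]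

variable {Λ σ X : Type} (A)

/-- A program, run on a machine with one more stack, one more label, and additional internal
memory `X`, none of which it uses. -/
def liftStmt (X : Type) : Stmt Γ Λ σ → Stmt (AddStack A Γ) (Option Λ) (σ × X)
  | .push k f q => .push (some k) (fun v => f v.1) (liftStmt X q)
  | .peek k f q => .peek (some k) (fun v a => (f v.1 a, v.2)) (liftStmt X q)
  | .pop k f q => .pop (some k) (fun v a => (f v.1 a, v.2)) (liftStmt X q)
  | .load f q => .load (fun v => (f v.1, v.2)) (liftStmt X q)
  | .branch f q₁ q₂ => .branch (fun v => f v.1) (liftStmt X q₁) (liftStmt X q₂)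
  | .goto f => .goto fun v => some (f v.1)
  | .halt => .halt

/-- The configuration in which the additional stack is empty and the additional memory is `x`. -/
def liftCfg (x : X) (c : Cfg Γ Λ σ) : Cfg (AddStack A Γ) (Option Λ) (σ × X) :=
  ⟨c.l.map some, (c.var, x), addStack [] c.stk⟩

theorem stepAux_liftStmt [DecidableEq K] (x : X) (q : Stmt Γ Λ σ) (v : σ) (S : ∀ k, List (Γ k)) :
    stepAux (liftStmt A X q) (v, x) (addStack [] S) = liftCfg A x (stepAux q v S) := by
  induction q generalizing v S with
  | push k f q ih => simp only [liftStmt, stepAux, update_addStack_some, ← ih]; rfl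
  | peek k f q ih => simp only [liftStmt, stepAux, ← ih]; rfl
  | pop k f q ih => simp only [liftStmt, stepAux, update_addStack_some, ← ih]; rfl
  | load f q ih => simp only [liftStmt, stepAux, ih]
  | branch f q₁ q₂ ih₁ ih₂ => simp only [liftStmt, stepAux, ih₁, ih₂]; cases f v <;> rfl
  | goto f => rfl
  | halt => rfl

end AddStack

/-- The stacks of `tm` when the input stack contains `s` and the others are empty. -/
def inputStk (tm : FinTM2) (s : List (tm.Γ tm.k₀)) : ∀ k, List (tm.Γ k) :=
  Function.update (fun _ => []) tm.k₀ s

theorem initList_eq (tm : FinTM2) (s : List (tm.Γ tm.k₀)) :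
    initList tm s = (⟨some tm.main, tm.initialState, inputStk tm s⟩ : Cfg _ _ _) := by
  unfold initList inputStk
  congr
  funext k
  obtain rfl | h := eq_or_ne k tm.k₀ <;> simp [*]

theorem inputStk_self (tm : FinTM2) (s : List (tm.Γ tm.k₀)) : inputStk tm s tm.k₀ = s :=
  Function.update_self ..

theorem inputStk_of_ne (tm : FinTM2) (s : List (tm.Γ tm.k₀)) {k : tm.K} (hk : k ≠ tm.k₀) :
    inputStk tm s k = [] :=
  Function.update_of_ne hk ..

theorem update_inputStk (tm : FinTM2) (s s' : List (tm.Γ tm.k₀)) :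
    Function.update (inputStk tm s) tm.k₀ s' = inputStk tm s' :=
  Function.update_idem ..

theorem sum_length_inputStk (tm : FinTM2) (s : List (tm.Γ tm.k₀)) :
    ∑ k ∈ tm.kFin.elems, (inputStk tm s k).length = s.length := by
  rw [Finset.sum_eq_single_of_mem tm.k₀ (tm.kFin.complete _), inputStk_self]
  exact fun k _ hk => congrArg List.length (inputStk_of_ne tm s hk)

/-! ### Running a transducer before a machine -/

variable {A B Q O : Type}

/-- On input `w`, the machine outputs exactly the words in `S`, each exactly once, with delay at
most `d` and in space at most `b`. -/
def Lists (M : EnumMachine A O) (w : List A) (S : Set (List O)) (d b : ℕ) : Prop :=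
  M.Enumerates w S ∧ M.DelayAtMost w d ∧ M.SpaceAtMost w b

theorem Lists.mono {M : EnumMachine A O} {w : List A} {S : Set (List O)} {d d' b b' : ℕ}
    (h : M.Lists w S d b) (hd : d ≤ d') (hb : b ≤ b') : M.Lists w S d' b' := by
  obtain ⟨henum, hdelay, hspace⟩ := h
  refine ⟨henum, fun t ht => ?_, fun t c hc => (hspace t c hc).trans hb⟩
  obtain ⟨s, hts, hsd, hs⟩ := hdelay t ht
  exact ⟨s, hts, hsd.trans (Nat.add_le_add_left hd t), hs⟩

theorem run_succ (M : EnumMachine A O) (w : List A) (t : ℕ) :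
    M.run w (t + 1) = (M.run w t).bind M.tm.step :=
  Function.iterate_succ_apply' _ _ _

section Shift

variable {N : EnumMachine A O} {M : EnumMachine B O} {w : List A} {w' : List B} {τ : ℕ}
  (hout : ∀ t out, N.OutputsAt w t out ↔ ∃ s, t = τ + s ∧ M.OutputsAt w' s out)
include hout

theorem Enumerates.shift {S : Set (List O)} (h : M.Enumerates w' S) : N.Enumerates w S := by
  obtain ⟨hmem, huniq⟩ := h
  refine ⟨fun out => ?_, fun s t out hs ht => ?_⟩
  · simp only [← hmem, hout]
    exact ⟨fun ⟨_, s, _, hs⟩ => ⟨s, hs⟩, fun ⟨s, hs⟩ => ⟨_, s, rfl, hs⟩⟩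
  · obtain ⟨s', rfl, hs'⟩ := (hout s out).1 hs
    obtain ⟨t', rfl, ht'⟩ := (hout t out).1 ht
    rw [huniq s' t' out hs' ht']

theorem DelayAtMost.shift (hrun : ∀ t, N.run w (τ + t) = none ↔ M.run w' t = none) {d : ℕ}
    (h : M.DelayAtMost w' d) : N.DelayAtMost w (τ + d) := by
  have event_of_run (t) (ht : M.run w' t ≠ none) : ∃ s, t < s ∧ s ≤ t + d ∧
      (N.run w (τ + s) = none ∨ ∃ out, N.OutputsAt w (τ + s) out) := by
    obtain ⟨s, hts, hsd, hs⟩ := h t ht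
    exact ⟨s, hts, hsd, hs.imp (hrun s).2 fun ⟨out, ho⟩ => ⟨out, (hout _ _).2 ⟨s, rfl, ho⟩⟩⟩
  intro t ht
  obtain htτ | ⟨t, rfl⟩ := (lt_or_ge t τ).imp_right Nat.exists_eq_add_of_le
  · obtain ⟨s, hs, hsd, hevent⟩ := event_of_run 0 (by simp [run])
    exact ⟨τ + s, by omega, by omega, hevent⟩
  · obtain ⟨s, hs, hsd, hevent⟩ := event_of_run t (mt (hrun t).2 ht)
    exact ⟨τ + s, by omega, by omega, hevent⟩

end Shift

section Preprocess

theorem finite_of_inputAlphabet (M : EnumMachine B O) : Finite B :=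
  haveI := M.finite_alphabets M.tm.k₀
  Finite.of_equiv _ M.inputAlphabet

variable [Nonempty B] (M : EnumMachine B O) (T : Transducer A Q B)

/-- The program that reads one letter from the additional stack and pushes what `T` writes on the
input stack of `M`. The additional memory holds the state of `T`, which is `none` after the end of
the word, and the letter to be pushed. -/
noncomputable def readStmt :
    Stmt (AddStack A M.tm.Γ) (Option M.tm.Λ) (M.tm.σ × Option Q × Option B) :=
  .pop none (fun v a => (v.1, T.read v.2.1 a)) <|
    .branch (fun v => v.2.2.isSome)
      (.push (some M.tm.k₀) (fun v => M.inputAlphabet.symm (v.2.2.getD (Classical.arbitrary B)))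
        next)
      next
where
  /-- Clear the written letter, and leave the loop once the word has ended. -/
  next := .load (fun v => (v.1, v.2.1, none)) <|
    .goto fun v => if v.2.1.isSome then none else some M.tm.main

variable [Finite A] [Finite Q]

/-- The machine that replaces its input `w` by the reverse of `T.output w` and then runs `M`. -/
noncomputable def preprocess : EnumMachine A O where
  tm :=
    { K := Option M.tm.K
      kDecidableEq := inferInstance
      kFin := @instFintypeOption _ M.tm.kFin
      k₀ := none
      k₁ := some M.tm.k₁
      Γ := AddStack A M.tm.Γ
      Λ := Option M.tm.Λ
      main := none
      ΛFin := @instFintypeOption _ M.tm.ΛFin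
      σ := M.tm.σ × Option Q × Option B
      initialState := (M.tm.initialState, some T.start, none)
      σFin :=
        haveI := M.finite_of_inputAlphabet
        @instFintypeProd _ _ M.tm.σFin (Fintype.ofFinite _)
      Γk₀Fin := Fintype.ofFinite A
      m := fun
        | none => M.readStmt T
        | some l => liftStmt A _ (M.tm.m l) }
  finite_alphabets
    | none => inferInstanceAs (Finite A)
    | some k => M.finite_alphabets k
  inputAlphabet := Equiv.refl A
  outputAlphabet := M.outputAlphabet
  outputLabels := some '' M.outputLabels

/-- The configuration of `M.preprocess T` in which `T` is in state `q`, `w` is still to be read,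
and the input stack of `M` contains `s`. -/
def readCfg (q : Q) (w : List A) (s : List B) : (M.preprocess T).tm.Cfg :=
  (⟨some none, (M.tm.initialState, some q, none),
    addStack w (inputStk M.tm (s.map M.inputAlphabet.symm))⟩ : Cfg _ _ _)

/-- The configuration of `M.preprocess T` corresponding to a configuration of `M`. -/
def simCfg (c : M.tm.Cfg) : (M.preprocess T).tm.Cfg :=
  liftCfg A ((none, none) : Option Q × Option B) c

theorem step_readCfg_cons (q : Q) (a : A) (w : List A) (s : List B) :
    (M.preprocess T).tm.step (M.readCfg T q (a :: w) s) =
      some (M.readCfg T (T.next q a).1 w ((T.next q a).2.toList ++ s)) := by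
  refine congrArg some ?_
  change stepAux (M.readStmt T) _ _ = _
  cases h : (T.next q a).2 <;>
    simp [readStmt, readStmt.next, Transducer.read, readCfg, h, update_addStack_none,
      update_addStack_some, addStack, inputStk_self, update_inputStk]

theorem step_readCfg_nil (q : Q) (s : List B) :
    (M.preprocess T).tm.step (M.readCfg T q [] s) = some (M.simCfg T
      (initList M.tm (((T.final q).toList ++ s).map M.inputAlphabet.symm))) := by
  refine congrArg some ?_
  rw [initList_eq]
  change stepAux (M.readStmt T) _ _ = _
  cases h : T.final q <;>
    simp [readStmt, readStmt.next, Transducer.read, simCfg, liftCfg, h, update_addStack_none,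
      update_addStack_some, addStack, inputStk_self, update_inputStk]

theorem step_simCfg (c : M.tm.Cfg) :
    (M.preprocess T).tm.step (M.simCfg T c) = (M.tm.step c).map (M.simCfg T) := by
  rcases c with ⟨_ | l, v, S⟩
  · rfl
  · exact congrArg some (stepAux_liftStmt _ _ _ _ _)

theorem run_preprocess_zero (w : List A) :
    (M.preprocess T).run w 0 = some (M.readCfg T T.start w []) := by
  refine congrArg some ((initList_eq _ _).trans ?_)
  unfold readCfg
  congr
  funext k
  obtain _ | k := k
  · exact (inputStk_self _ _).trans (List.map_id w)
  · refine (Function.update_of_ne (Option.some_ne_none k) _ _).trans ?_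
    obtain rfl | hk := eq_or_ne k M.tm.k₀
    · exact (inputStk_self _ _).symm
    · exact (inputStk_of_ne _ [] hk).symm

theorem run_preprocess_of_le (w : List A) {t : ℕ} (ht : t ≤ w.length) :
    ∃ q s, (M.preprocess T).run w t = some (M.readCfg T q (w.drop t) s) ∧
      (T.eval q (w.drop t)).reverse ++ s = (T.output w).reverse := by
  induction t with
  | zero => exact ⟨_, _, M.run_preprocess_zero T w, List.append_nil _⟩
  | succ t ih =>
    obtain ⟨q, s, hrun, heval⟩ := ih (by omega)
    rw [List.drop_eq_getElem_cons ht] at hrun heval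
    refine ⟨(T.next q w[t]).1, (T.next q w[t]).2.toList ++ s, ?_, ?_⟩
    · rw [run_succ, hrun, Option.bind_some, step_readCfg_cons]
    · rw [← heval, Transducer.eval, List.reverse_append, List.append_assoc]
      cases (T.next q w[t]).2 <;> rfl

theorem run_preprocess_add (w : List A) (t : ℕ) :
    (M.preprocess T).run w (w.length + 1 + t) =
      (M.run (T.output w).reverse t).map (M.simCfg T) := by
  induction t with
  | zero =>
    obtain ⟨q, s, hrun, heval⟩ := M.run_preprocess_of_le T w le_rfl
    rw [List.drop_length] at hrun heval
    rw [Nat.add_zero, run_succ, hrun, Option.bind_some, step_readCfg_nil, ← heval]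
    unfold Transducer.eval
    cases T.final q <;> rfl
  | succ t ih =>
    rw [← Nat.add_assoc, run_succ, ih, run_succ]
    cases M.run (T.output w).reverse t with
    | none => rfl
    | some c => exact M.step_simCfg T c

theorem outputsAt_preprocess_add (w : List A) (t : ℕ) (out : List O) :
    (M.preprocess T).OutputsAt w (w.length + 1 + t) out ↔
      M.OutputsAt (T.output w).reverse t out := by
  unfold OutputsAt
  rw [run_preprocess_add]
  constructor
  · rintro ⟨_, hc', ⟨_, ⟨l, hl, rfl⟩, hl'⟩, hout⟩
    obtain ⟨c, hc, rfl⟩ := Option.map_eq_some_iff.1 hc'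
    exact ⟨c, hc, ⟨l, hl, Option.map_injective (Option.some_injective _) hl'⟩, hout⟩
  · rintro ⟨c, hc, ⟨l, hl, hl'⟩, hout⟩
    exact ⟨M.simCfg T c, Option.map_eq_some_iff.2 ⟨c, hc, rfl⟩,
      ⟨some l, Set.mem_image_of_mem _ hl, congrArg (Option.map some) hl'⟩, hout⟩

theorem outputsAt_preprocess (w : List A) (t : ℕ) (out : List O) :
    (M.preprocess T).OutputsAt w t out ↔
      ∃ s, t = w.length + 1 + s ∧ M.OutputsAt (T.output w).reverse s out := by
  constructor
  · intro h
    obtain ht | ht := le_or_gt t w.length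
    · obtain ⟨q, s, hrun, -⟩ := M.run_preprocess_of_le T w ht
      obtain ⟨c, hc, ⟨_, ⟨l, -, rfl⟩, hl⟩, -⟩ := h
      cases hrun.symm.trans hc
      cases hl
    · obtain ⟨s, rfl⟩ := Nat.exists_eq_add_of_le (Nat.succ_le_of_lt ht)
      exact ⟨s, rfl, (M.outputsAt_preprocess_add T w s out).1 h⟩
  · rintro ⟨s, rfl, h⟩
    exact (M.outputsAt_preprocess_add T w s out).2 h

theorem sum_length_addStack (w : List A) (S : ∀ k, List (M.tm.Γ k)) :
    ∑ k ∈ (M.preprocess T).tm.kFin.elems, (addStack w S k).length =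
      w.length + ∑ k ∈ M.tm.kFin.elems, (S k).length :=
  letI := M.tm.kFin
  Fintype.sum_option fun k => (addStack w S k).length

variable {M T}

theorem SpaceAtMost.preprocess {w : List A} {b : ℕ} (h : M.SpaceAtMost (T.output w).reverse b) :
    (M.preprocess T).SpaceAtMost w (b + (2 * w.length + 1)) := by
  intro t c hc
  obtain ht | ht := le_or_gt t w.length
  · obtain ⟨q, s, hrun, heval⟩ := M.run_preprocess_of_le T w ht
    obtain rfl := Option.some_injective _ (hrun.symm.trans hc)
    refine (M.sum_length_addStack T _ _).trans_le ?_
    have length_le : s.length ≤ w.length + 1 :=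
      calc
        s.length ≤ ((T.eval q (w.drop t)).reverse ++ s).length := by simp
        _ = (T.output w).length := by rw [heval, List.length_reverse]
        _ ≤ w.length + 1 := T.length_eval_le _ w
    rw [sum_length_inputStk, List.length_drop, List.length_map]
    omega
  · obtain ⟨t, rfl⟩ := Nat.exists_eq_add_of_le (Nat.succ_le_of_lt ht)
    rw [run_preprocess_add] at hc
    obtain ⟨c, hc', rfl⟩ := Option.map_eq_some_iff.1 hc
    refine (M.sum_length_addStack T _ _).trans_le ?_
    rw [List.length_nil, Nat.zero_add]
    exact Nat.le_add_right_of_le (h t c hc')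

theorem Lists.preprocess {w : List A} {S : Set (List O)} {d b : ℕ}
    (h : M.Lists (T.output w).reverse S d b) :
    (M.preprocess T).Lists w S (w.length + 1 + d) (b + (2 * w.length + 1)) := by
  obtain ⟨henum, hdelay, hspace⟩ := h
  have hout := M.outputsAt_preprocess T w
  refine ⟨henum.shift hout, hdelay.shift hout fun t => ?_, hspace.preprocess⟩
  rw [run_preprocess_add, Option.map_eq_none_iff]

end Preprocess

end EnumMachine

/-! ### Polynomial preprocessing -/

/-- Replacing the input by its image under `f` turns enumeration algorithms with polynomial delay
and in polynomial space into such algorithms. -/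
def IsPolyPreprocessing {A B : Type} (f : List A → List B) : Prop :=
  ∀ ⦃O : Type⦄ (M : EnumMachine B O) (d b : Polynomial ℕ),
    ∃ (M' : EnumMachine A O) (d' b' : Polynomial ℕ), ∀ (w : List A) (S : Set (List O)),
      M.Lists (f w) S (d.eval (f w).length) (b.eval (f w).length) →
        M'.Lists w S (d'.eval w.length) (b'.eval w.length)

theorem monotone_eval_nat (p : Polynomial ℕ) : Monotone fun n => p.eval n := by
  intro m n hmn
  simp only [Polynomial.eval_eq_sum_range]
  gcongr

theorem IsPolyPreprocessing.comp {A B C : Type} {g : List B → List C} {f : List A → List B}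
    (hg : IsPolyPreprocessing g) (hf : IsPolyPreprocessing f) :
    IsPolyPreprocessing fun w => g (f w) := by
  intro O M d b
  obtain ⟨M₁, d₁, b₁, h₁⟩ := hg M d b
  obtain ⟨M₂, d₂, b₂, h₂⟩ := hf M₁ d₁ b₁
  exact ⟨M₂, d₂, b₂, fun w S h => h₂ w S (h₁ (f w) S h)⟩

namespace Transducer

variable {A B Q : Type}

theorem isPolyPreprocessing_reverse_output [Finite A] [Finite Q] [Nonempty B]
    (T : Transducer A Q B) : IsPolyPreprocessing fun w => (T.output w).reverse := by
  intro O M d b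
  refine ⟨M.preprocess T, .X + 1 + d.comp (.X + 1), b.comp (.X + 1) + (2 * .X + 1),
    fun w S h => ?_⟩
  have length_le : (T.output w).reverse.length ≤ w.length + 1 := by
    rw [List.length_reverse]
    exact T.length_eval_le _ w
  simpa using
    (h.mono (monotone_eval_nat d length_le) (monotone_eval_nat b length_le)).preprocess

/-- The transducer that translates a word by `g`, but moves the translation of each letter held
back to just before that of the next such letter, or to the end of the word. Its state is the
letter that it is holding back. -/
def delay (g : A → B) (held : A → Bool) : Transducer A (Option B) B where
  start := none
  next buf a := if held a then (some (g a), buf) else (buf, some (g a))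
  final := id

variable {g : A → B} {held : A → Bool}

theorem eval_delay_cons_of_held {a : A} (ha : held a = true) (buf : Option B) (w : List A) :
    (delay g held).eval buf (a :: w) = buf.toList ++ (delay g held).eval (some (g a)) w := by
  simp [eval, delay, ha]

theorem eval_delay_cons_of_not_held {a : A} (ha : held a = false) (buf : Option B) (w : List A) :
    (delay g held).eval buf (a :: w) = g a :: (delay g held).eval buf w := by
  simp [eval, delay, ha]

theorem eval_delay_append_of_not_held {u : List A} (hu : ∀ a ∈ u, held a = false) (buf : Option B)
    (w : List A) : (delay g held).eval buf (u ++ w) = u.map g ++ (delay g held).eval buf w := by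
  induction u with
  | nil => rfl
  | cons a u ih =>
    rw [List.forall_mem_cons] at hu
    rw [List.cons_append, eval_delay_cons_of_not_held hu.1, ih hu.2]
    rfl

theorem eval_delay_of_held {w : List A} (hw : ∀ a ∈ w, held a = true) (buf : Option B) :
    (delay g held).eval buf w = buf.toList ++ w.map g := by
  induction w generalizing buf with
  | nil => exact (List.append_nil _).symm
  | cons a w ih =>
    rw [List.forall_mem_cons] at hw
    rw [eval_delay_cons_of_held hw.1, ih hw.2]
    rfl

theorem eval_delay_flatMap_append {I : Type} {h : I → A} {u : I → List A} {w : List A}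
    (hh : ∀ x, held (h x) = true) (hu : ∀ x, ∀ a ∈ u x, held a = false)
    (hw : ∀ a ∈ w, held a = true) (l : List I) (buf : Option B) :
    (delay g held).eval buf (l.flatMap (fun x => h x :: u x) ++ w) =
      buf.toList ++ l.flatMap (fun x => (u x).map g ++ [g (h x)]) ++ w.map g := by
  induction l generalizing buf with
  | nil => simpa using eval_delay_of_held hw buf
  | cons x l ih =>
    rw [List.flatMap_cons, List.append_assoc, List.cons_append, eval_delay_cons_of_held (hh x),
      eval_delay_append_of_not_held (hu x), ih]
    simp

end Transducer

theorem isPolyPreprocessing_reverse {A : Type} [Finite A] [Nonempty A] :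
    IsPolyPreprocessing (List.reverse (α := A)) := by
  have output_delay (w : List A) : (Transducer.delay id fun _ : A => false).output w = w := by
    simpa [Transducer.eval, Transducer.delay, Transducer.output] using
      Transducer.eval_delay_append_of_not_held (g := id) (u := w) (fun _ _ => rfl) none []
  simpa only [output_delay] using
    (Transducer.delay id fun _ : A => false).isPolyPreprocessing_reverse_output

theorem Transducer.isPolyPreprocessing_output {A B Q : Type} [Finite A] [Finite B] [Finite Q]
    [Nonempty B] (T : Transducer A Q B) : IsPolyPreprocessing T.output := by
  simpa only [List.reverse_reverse] using
    isPolyPreprocessing_reverse.comp T.isPolyPreprocessing_reverse_output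

/-! ### Translating formulas and multigraphs into one another -/

/-- The correspondence between the letters of formulas and those of multigraphs. -/
def formulaSymEquivGraphSym : FormulaSym ≃ GraphSym where
  toFun
    | .tick => .tick
    | .bit b => .bit b
    | .plus => .sep
    | .rhs r => .color (rhsEquivColor r)
  invFun
    | .tick => .tick
    | .bit b => .bit b
    | .sep => .plus
    | .color c => .rhs (rhsEquivColor.symm c)
  left_inv := by rintro (_ | _ | _ | _) <;> simp
  right_inv := by rintro (_ | _ | _ | _) <;> simp

instance : Finite FormulaSym :=
  .of_injective (β := Option (Option (Bool ⊕ ZMod 2)))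
    (fun | .tick => none | .plus => some none | .bit b => some (some (.inl b))
         | .rhs r => some (some (.inr r)))
    (by rintro (_ | _ | _ | _) (_ | _ | _ | _) <;> simp)

instance : Finite GraphSym :=
  .of_equiv _ formulaSymEquivGraphSym

instance : Nonempty FormulaSym :=
  ⟨.tick⟩

instance : Nonempty GraphSym :=
  ⟨.tick⟩

/-- The letters that are held back in translating multigraphs. -/
def GraphSym.isHeld : GraphSym → Bool
  | .color _ => true
  | _ => false

/-- The letters that are held back in translating reversed formulas. Ticks are among them because
the last right-hand side has to be written before the ticks that follow it. -/
def FormulaSym.isHeld : FormulaSym → Bool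
  | .rhs _ => true
  | .tick => true
  | _ => false

/-- The transducer from multigraphs to formulas: it moves each color to the end of its edge. -/
def graphToFormula : Transducer GraphSym (Option FormulaSym) FormulaSym :=
  .delay formulaSymEquivGraphSym.symm GraphSym.isHeld

/-- The transducer from reversed formulas to reversed multigraphs: it moves each right-hand side
from the beginning to the end of its reversed clause. -/
def formulaToGraph : Transducer FormulaSym (Option GraphSym) GraphSym :=
  .delay formulaSymEquivGraphSym FormulaSym.isHeld

section EncodeVerts

variable {A B : Type} (bit : Bool → A) (sep : A) {n : ℕ}

/-- The word by which a clause describes its variables, and an edge its end points. -/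
def encodeVerts (V : Finset (Fin n)) : List A :=
  (V.sort (· ≤ ·)).flatMap fun x : Fin n => encodeNatSep bit sep x

theorem map_encodeVerts (g : A → B) (V : Finset (Fin n)) :
    (encodeVerts bit sep V).map g = encodeVerts (g ∘ bit) (g sep) V := by
  simp [encodeVerts, encodeNatSep, List.map_flatMap]

variable {bit sep} in
theorem eq_bit_or_eq_sep_of_mem_encodeVerts {V : Finset (Fin n)} {a : A}
    (ha : a ∈ encodeVerts bit sep V) : (∃ b, a = bit b) ∨ a = sep := by
  simp only [encodeVerts, encodeNatSep, List.mem_flatMap, List.mem_append, List.mem_map,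
    List.mem_singleton] at ha
  obtain ⟨_, -, ⟨b, -, rfl⟩ | rfl⟩ := ha
  exacts [.inl ⟨b, rfl⟩, .inr rfl]

end EncodeVerts

theorem GraphSym.isHeld_of_mem_encodeVerts {n : ℕ} {V : Finset (Fin n)} {a : GraphSym}
    (ha : a ∈ encodeVerts .bit .sep V) : a.isHeld = false := by
  obtain ⟨_, rfl⟩ | rfl := eq_bit_or_eq_sep_of_mem_encodeVerts ha <;> rfl

theorem FormulaSym.isHeld_of_mem_encodeVerts {n : ℕ} {V : Finset (Fin n)} {a : FormulaSym}
    (ha : a ∈ encodeVerts .bit .plus V) : a.isHeld = false := by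
  obtain ⟨_, rfl⟩ | rfl := eq_bit_or_eq_sep_of_mem_encodeVerts ha <;> rfl

theorem XORClause.encode_eq {n : ℕ} (C : XORClause n) :
    C.encode = encodeVerts .bit .plus C.vars ++ [.rhs C.rhs] :=
  rfl

theorem XORClause.encode_toEdge {n : ℕ} (C : XORClause n) :
    C.toEdge.encode = .color (rhsEquivColor C.rhs) :: encodeVerts .bit .sep C.vars :=
  rfl

namespace GraphicXORCNF

variable (φ : GraphicXORCNF)

theorem encode_toGraph : φ.toGraph.encode =
    List.replicate φ.n .tick ++ (List.ofFn φ.clause).flatMap fun C => C.toEdge.encode := by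
  change _ ++ (List.ofFn (XORClause.toEdge ∘ φ.clause)).flatMap _ = _
  rw [← List.map_ofFn, List.flatMap_map]

theorem output_graphToFormula : graphToFormula.output φ.toGraph.encode = φ.encode := by
  have not_held_tick : ∀ a ∈ List.replicate φ.n GraphSym.tick, a.isHeld = false := by
    simp [GraphSym.isHeld]
  have translate_edge (C : XORClause φ.n) :
      (encodeVerts .bit .sep C.vars).map formulaSymEquivGraphSym.symm ++
        [formulaSymEquivGraphSym.symm (.color (rhsEquivColor C.rhs))] = C.encode := by
    rw [map_encodeVerts, C.encode_eq]
    exact congrArg (_ ++ [·]) (formulaSymEquivGraphSym.symm_apply_apply (.rhs C.rhs))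
  calc
    graphToFormula.output φ.toGraph.encode
    _ = (List.replicate φ.n .tick).map formulaSymEquivGraphSym.symm ++ graphToFormula.eval none
          ((List.ofFn φ.clause).flatMap (fun C => C.toEdge.encode) ++ []) := by
      rw [encode_toGraph, List.append_nil]
      exact Transducer.eval_delay_append_of_not_held not_held_tick none _
    _ = (List.replicate φ.n .tick).map formulaSymEquivGraphSym.symm ++
          (List.ofFn φ.clause).flatMap XORClause.encode := by
      simp only [XORClause.encode_toEdge]
      rw [graphToFormula, Transducer.eval_delay_flatMap_append (fun _ => rfl)
        (fun _ _ => GraphSym.isHeld_of_mem_encodeVerts) (by simp)]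
      simp [translate_edge]
    _ = φ.encode := congrArg (· ++ _) List.map_replicate

theorem reverse_output_formulaToGraph :
    (formulaToGraph.output φ.encode.reverse).reverse = φ.toGraph.encode := by
  have held_tick : ∀ a ∈ List.replicate φ.n FormulaSym.tick, a.isHeld = true := by
    simp [FormulaSym.isHeld]
  have translate_clause (C : XORClause φ.n) : formulaSymEquivGraphSym (.rhs C.rhs) ::
      (encodeVerts .bit .plus C.vars).map formulaSymEquivGraphSym = C.toEdge.encode :=
    congrArg _ (map_encodeVerts ..)
  calc
    (formulaToGraph.output φ.encode.reverse).reverse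
    _ = (formulaToGraph.eval none ((List.ofFn φ.clause).reverse.flatMap (fun C =>
          .rhs C.rhs :: (encodeVerts .bit .plus C.vars).reverse) ++
            List.replicate φ.n .tick)).reverse := by
      simp [Transducer.output, formulaToGraph, Transducer.delay, encode, List.reverse_flatMap,
        Function.comp_def, XORClause.encode_eq]
    _ = (List.replicate φ.n .tick).map formulaSymEquivGraphSym ++
          (List.ofFn φ.clause).flatMap fun C => C.toEdge.encode := by
      rw [formulaToGraph, Transducer.eval_delay_flatMap_append (fun _ => rfl)
        (fun _ _ ha => FormulaSym.isHeld_of_mem_encodeVerts (List.mem_reverse.1 ha)) held_tick]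
      simp [List.reverse_flatMap, Function.comp_def, translate_clause]
    _ = φ.toGraph.encode := by
      rw [encode_toGraph, List.map_replicate]
      rfl

end GraphicXORCNF

theorem theorem4p3 :
    (maximalSignatures.PolyDelayPolySpace ↔
      maximalRedBlueBipartiteSubgraphs.PolyDelayPolySpace) ∧
    Function.Bijective GraphicXORCNF.toGraph ∧
    ∀ φ : GraphicXORCNF,
      (∀ σ : Fin φ.m → Bool, φ.IsMaximalSignature σ ↔
        φ.toGraph.IsMaximalRedBlueBipartite (φ.subgraphOf σ)) ∧
      Set.BijOn φ.subgraphOf {σ | φ.IsMaximalSignature σ}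
        {H | φ.toGraph.IsMaximalRedBlueBipartite H} := by
  refine ⟨⟨?_, ?_⟩, GraphicXORCNF.toGraph_bijective,
    fun φ => ⟨φ.isMaximalSignature_iff, φ.bijOn_subgraphOf⟩⟩
  · rintro ⟨M, d, b, hM⟩
    obtain ⟨M', d', b', hM'⟩ := graphToFormula.isPolyPreprocessing_output M d b
    refine ⟨M', d', b', fun G => hM' _ _ ?_⟩
    obtain ⟨φ, rfl⟩ := GraphicXORCNF.toGraph_bijective.surjective G
    rw [φ.output_graphToFormula, φ.image_encodeSubgraph]
    exact hM φ
  · rintro ⟨M, d, b, hM⟩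
    obtain ⟨M', d', b', hM'⟩ := formulaToGraph.isPolyPreprocessing_reverse_output.comp
      isPolyPreprocessing_reverse M d b
    refine ⟨M', d', b', fun φ => hM' _ _ ?_⟩
    beta_reduce
    rw [φ.reverse_output_formulaToGraph, ← φ.image_encodeSubgraph]
    exact hM φ.toGraph
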